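/- A BW-game consists of a finite directed graph $G=(V,E)$ in which every vertex (position) has an outgoing arc, a partition $V=B\cup W$ of the positions between two players MIN (controlling $B$) and MAX (controlling $W$), and local rewards $r:E\to\mathbb R$. From an initial position $v_0$ the player controlling the current position chooses an outgoing arc along which the play moves, at every time step. A strategy of a player may depend on the whole history and may randomize: it assigns to every finite history ending in a position of that player a probability distribution on the outgoing arcs. A pure stationary strategy selects one outgoing arc at each position of the player. For strategies $\mathbf b$ of MIN and $\mathbf w$ of MAX let $a=a(v_0;\mathbf b,\mathbf w)=(a_1,a_2,\dots)$ be the sequence of expected local rewards. For a real sequence $a$ put $M(a)_i=\sum_{j\le i}a_j$, $$A_T^{(k)}(a)=\frac1T\sum_{j=1}^T \bigl(M^k(a)\bigr)_j,\qquad \phi^{(k)}(a)=\liminf_{T\to\infty}A_T^{(k)}(a)\in[-\infty,+\infty].$$ In the $k$-total reward BW-game ($k=0,1,2,\dots$), MIN pays MAX the amount $\phi^{(k)}(a(v_0;\mathbf b,\mathbf w))$. **Theorem.** In every $k$-total reward BW-game the following hold. 1. For every pure stationary strategy $\mathbf b$ of MIN there is a pure stationary strategy $\mathbf w^*$ of MAX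 which, for every initial position $v_0$, is a best response to $\mathbf b$ among all (history-dependent, randomized) strategies, and dominates them uniformly: for every strategy $\mathbf w$ of MAX, $$\limsup_{T\to\infty}A_T^{(k)}(a(v_0;\mathbf b,\mathbf w))\le \phi^{(k)}(a(v_0;\mathbf b,\mathbf w^*)),$$ and for every real $x>\phi^{(k)}(a(v_0;\mathbf b,\mathbf w^*))$ there is $T_0$ such that $A_T^{(k)}(a(v_0;\mathbf b,\mathbf w))\le x$ for all $T\ge T_0$ and all strategies $\mathbf w$ of MAX. 2. Symmetrically, for every pure stationary strategy $\mathbf w$ of MAX there is a pure stationary strategy $\mathbf b^*$ of MIN which, for every $v_0$, is a best response to $\mathbf w$ among all strategies, with $$\liminf_{T\to\infty}A_T^{(k)}(a(v_0;\mathbf b,\mathbf w))\ge \phi^{(k)}(a(v_0;\mathbf b^*,\mathbf w))$$ for every strategy $\mathbf b$ of MIN, and for every real $x<\phi^{(k)}(a(v_0;\mathbf b^*,\mathbf w))$ there is $T_0$ such that $A_T^{(k)}(a(v_0;\mathbf b,\mathbf w))\ge x$ for all $T\ge T_0$ and all strategies $\mathbf b$ of MIN. 3. There are pure stationary strategies $\mathbf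 b^*$ of MIN and $\mathbf w^*$ of MAX that form a saddle point among all strategies, simultaneously for all initial positions: for all $v_0$ and all strategies $\mathbf b$ of MIN and $\mathbf w$ of MAX, $$\phi^{(k)}(a(v_0;\mathbf b^*,\mathbf w))\le\phi^{(k)}(a(v_0;\mathbf b^*,\mathbf w^*))\le\phi^{(k)}(a(v_0;\mathbf b,\mathbf w^*)).$$ -/

import Mathlib

open Filter

/-- The two players: the minimizer (Black) and the maximizer (White). -/
inductive Player where
  | min
  | max

/-- A BW-game (without its effective reward) on the set of positions `V`: a directed graph in
which every position has an outgoing arc, a partition of the positions between the two players,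
and a local reward on the arcs. Only the values of `reward` on arcs of the graph are ever
collected, since all plays move along arcs. -/
structure BWGame (V : Type*) where
  graph : Digraph V
  owner : V → Player
  exists_adj : ∀ v, ∃ u, graph.Adj v u
  reward : V → V → ℝ

/-- The moment operator: `(a₁, a₂, a₃, …) ↦ (a₁, a₁ + a₂, a₁ + a₂ + a₃, …)`. The term `a (i)` of
a sequence `a : ℕ → ℝ` is the entry with index `i + 1` in the mathematical notation. -/
def moment (a : ℕ → ℝ) : ℕ → ℝ := fun i => ∑ j ∈ Finset.range (i + 1), a j

/-- The time average `(1 / T) ∑_{j = 1}^T M^k(a)_j` of the `k`-th moment sequence of `a`. -/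
noncomputable def momentAverage (k : ℕ) (a : ℕ → ℝ) (T : ℕ) : ℝ :=
  (∑ j ∈ Finset.range T, (moment^[k] a) j) / (T : ℝ)

/-- The `k`-total reward of a sequence of local rewards, a value in `[-∞, +∞]`. -/
noncomputable def kTotalReward (k : ℕ) (a : ℕ → ℝ) : EReal :=
  liminf (fun T : ℕ => (momentAverage k a T : EReal)) atTop

namespace BWGame

variable {V : Type*}

/-- A pure stationary strategy of player `p`: one outgoing arc at each position of `p`. -/
structure PureStationary (G : BWGame V) (p : Player) where
  next : ∀ v, G.owner v = p → V
  adj : ∀ v (hv : G.owner v = p), G.graph.Adj v (next v hv)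

/-- An arbitrary strategy of player `p` (history dependent and randomized): to each finite
sequence of positions `h 0, …, h t` (the history up to time `t`) that ends in a position of `p`,
it assigns a probability distribution on the out-neighbours of the current position `h t`. -/
structure Strategy (G : BWGame V) (p : Player) where
  move : ∀ (t : ℕ) (h : Fin (t + 1) → V), G.owner (h (Fin.last t)) = p → PMF V
  adj : ∀ (t : ℕ) (h : Fin (t + 1) → V) (hp : G.owner (h (Fin.last t)) = p),
    ∀ u ∈ (move t h hp).support, G.graph.Adj (h (Fin.last t)) u

/-- A pure stationary strategy, seen as a strategy. -/
noncomputable def PureStationary.toStrategy {G : BWGame V} {p : Player}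
    (σ : G.PureStationary p) : G.Strategy p where
  move t h hp := PMF.pure (σ.next (h (Fin.last t)) hp)
  adj t h hp u hu := by
    rw [PMF.support_pure, Set.mem_singleton_iff] at hu
    rw [hu]
    exact σ.adj _ hp

/-- The distribution of the next position after the history `h`: the owner of the current
position moves. -/
noncomputable def step {G : BWGame V} (b : G.Strategy .min) (w : G.Strategy .max) (t : ℕ)
    (h : Fin (t + 1) → V) : PMF V :=
  match hp : G.owner (h (Fin.last t)) with
  | .min => b.move t h hp
  | .max => w.move t h hp

/-- The law of the history `(s₀, …, s_t)` when the play starts in `v₀` and the players use the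
strategies `b` and `w`. -/
noncomputable def historyLaw {G : BWGame V} (b : G.Strategy .min) (w : G.Strategy .max) (v₀ : V) :
    (t : ℕ) → PMF (Fin (t + 1) → V)
  | 0 => PMF.pure fun _ => v₀
  | t + 1 => (historyLaw b w v₀ t).bind fun h =>
      (step b w t h).map fun u => (Fin.snoc h u : Fin (t + 2) → V)

/-- The sequence of expected local rewards: its term `t` is the expectation of the reward
`r (s_t, s_{t+1})` of the move made at time `t`. -/
noncomputable def expectedRewards [Fintype V] {G : BWGame V} (b : G.Strategy .min)
    (w : G.Strategy .max) (v₀ : V) : ℕ → ℝ := fun t =>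
  ∑ h : Fin (t + 2) → V,
    (historyLaw b w v₀ (t + 1) h).toReal *
      G.reward (h (Fin.last t).castSucc) (h (Fin.last (t + 1)))

/-- The payoff `φ^(k)(a(b, w))` of the `k`-total reward BW-game with initial position `v₀`. -/
noncomputable def payoff [Fintype V] {G : BWGame V} (k : ℕ) (b : G.Strategy .min)
    (w : G.Strategy .max) (v₀ : V) : EReal :=
  kTotalReward k (expectedRewards b w v₀)

/-- `w` is a best response of the maximizer to `b` among all strategies. -/
def IsBestResponseMax [Fintype V] {G : BWGame V} (k : ℕ) (v₀ : V) (b : G.Strategy .min)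
    (w : G.Strategy .max) : Prop :=
  ∀ w' : G.Strategy .max, payoff k b w' v₀ ≤ payoff k b w v₀

/-- `b` is a best response of the minimizer to `w` among all strategies. -/
def IsBestResponseMin [Fintype V] {G : BWGame V} (k : ℕ) (v₀ : V) (b : G.Strategy .min)
    (w : G.Strategy .max) : Prop :=
  ∀ b' : G.Strategy .min, payoff k b w v₀ ≤ payoff k b' w v₀

/-- `(b, w)` is a saddle point, among all strategies, for the initial position `v₀`. -/
def IsSaddlePoint [Fintype V] {G : BWGame V} (k : ℕ) (v₀ : V) (b : G.Strategy .min)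
    (w : G.Strategy .max) : Prop :=
  IsBestResponseMax k v₀ b w ∧ IsBestResponseMin k v₀ b w

end BWGame

/-! The averages of the `k`-th moments are, up to an index shift, `moment^[k + 1] a n / (n + 1)`,
and `moment^[k + 1] a n` is the sum of the rewards `a i` with weights `(n - i + k).choose k`, the
coefficients of `1 / (1 - x) ^ (k + 1)`. A function `F n v` that satisfies the Bellman conditions
for these weights at all large horizons `n` therefore controls every play: expected potentials
telescope, and only a bounded error remains, the same for all strategies, which the division by `n +
1` removes.

Such an `F` comes from the discounted game. Since there are finitely many selections of arcs, one
selection `σ` is optimal for discount factors `β` arbitrarily close to `1`. Its value is rational in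
`β`, with denominator `1 - β ^ L`. Dividing it by `(1 - β) ^ (k + 1)` and taking coefficients turns
the discounted Bellman conditions into finite horizon ones. Inequalities survive because a
polynomial that is nonnegative arbitrarily close to `1` from below yields eventually nonnegative
coefficients over any power of `1 - x` (`eventually_poleCoeff_nonneg`). To keep `1` as the only
pole, the factor `1 + x + ... + x ^ (L - 1)` of the denominator is inverted modulo a power of `1 -
x` (`exists_inverse_geom_sum`), which changes only finitely many coefficients. Then `F n v` is
eventually a polynomial in `n`, so `F n v / (n + 1)` has a limit in `EReal`: the value of the game
(`exists_isHorizonOptimal`).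

For best responses the same is applied to the game in which one player is bound to a given pure
stationary strategy. -/

open scoped Topology Polynomial PowerSeries

/-! ### Coefficients of rational functions whose only pole is at `1` -/

/-- The coefficient of `x ^ n` in the expansion of the rational function `p / (1 - x) ^ d`. -/
noncomputable def poleCoeff (d : ℕ) (p : ℝ[X]) (n : ℕ) : ℝ :=
  PowerSeries.coeff n ((p : ℝ⟦X⟧) * (PowerSeries.mk 1 : ℝ⟦X⟧) ^ d)

theorem poleCoeff_sub (d : ℕ) (p q : ℝ[X]) (n : ℕ) :
    poleCoeff d (p - q) n = poleCoeff d p n - poleCoeff d q n := by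
  simp [poleCoeff, sub_mul]

theorem poleCoeff_X_mul (d : ℕ) (p : ℝ[X]) (n : ℕ) :
    poleCoeff d (Polynomial.X * p) (n + 1) = poleCoeff d p n := by
  simp [poleCoeff, mul_assoc, PowerSeries.coeff_succ_X_mul]

theorem poleCoeff_succ_one_sub_X_mul (d : ℕ) (p : ℝ[X]) (n : ℕ) :
    poleCoeff (d + 1) ((1 - Polynomial.X) * p) n = poleCoeff d p n := by
  have h := PowerSeries.mk_one_mul_one_sub_eq_one ℝ
  unfold poleCoeff
  congr 1
  rw [Polynomial.coe_mul, Polynomial.coe_sub, Polynomial.coe_one, Polynomial.coe_X, pow_succ]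
  linear_combination ((p : ℝ⟦X⟧) * PowerSeries.mk 1 ^ d) * h

theorem poleCoeff_add_one_sub_X_pow_mul (d e : ℕ) (p : ℝ[X]) (n : ℕ) :
    poleCoeff (d + e) ((1 - Polynomial.X) ^ e * p) n = poleCoeff d p n := by
  induction e with
  | zero => simp
  | succ e ih => rw [← add_assoc, pow_succ', mul_assoc, poleCoeff_succ_one_sub_X_mul, ih]

theorem coeff_mul_mk_one (f : ℝ⟦X⟧) (n : ℕ) :
    PowerSeries.coeff n (f * (PowerSeries.mk 1 : ℝ⟦X⟧)) =
      ∑ i ∈ Finset.range (n + 1), PowerSeries.coeff i f := by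
  rw [PowerSeries.coeff_mul, Finset.Nat.sum_antidiagonal_eq_sum_range_succ_mk]
  simp

theorem poleCoeff_succ (d : ℕ) (p : ℝ[X]) (n : ℕ) :
    poleCoeff (d + 1) p n = ∑ i ∈ Finset.range (n + 1), poleCoeff d p i := by
  unfold poleCoeff
  rw [pow_succ, ← mul_assoc, coeff_mul_mk_one]

theorem poleCoeff_C (d : ℕ) (r : ℝ) (n : ℕ) :
    poleCoeff (d + 1) (Polynomial.C r) n = ((n + d).choose d : ℝ) * r := by
  unfold poleCoeff
  rw [PowerSeries.mk_one_pow_eq_mk_choose_add]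
  simp [mul_comm, add_comm]

theorem eventually_poleCoeff_zero (p : ℝ[X]) : ∀ᶠ n in atTop, poleCoeff 0 p n = 0 := by
  filter_upwards [eventually_gt_atTop p.natDegree] with n hn
  simp [poleCoeff, Polynomial.coeff_eq_zero_of_natDegree_lt hn]

theorem eventually_poleCoeff_one (p : ℝ[X]) :
    ∀ᶠ n in atTop, poleCoeff 1 p n = p.eval 1 := by
  filter_upwards [eventually_gt_atTop p.natDegree] with n hn
  rw [poleCoeff_succ, Polynomial.eval_eq_sum_range' (n := n + 1) (by omega)]
  simp [poleCoeff]

/-- For a simple pole the coefficients are eventually `p.eval 1`. Each further factor `1 / (1 - x)`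
takes partial sums, and partial sums of a sequence eventually bounded below by `c > 0` tend to
infinity. -/
theorem exists_eventually_le_poleCoeff (d : ℕ) (p : ℝ[X]) (hp : 0 < p.eval 1) :
    ∃ c > 0, ∀ᶠ n in atTop, c ≤ poleCoeff (d + 1) p n := by
  induction d with
  | zero =>
    exact ⟨_, hp, (eventually_poleCoeff_one p).mono fun n hn => hn.ge⟩
  | succ d ih =>
    obtain ⟨c, hc, h⟩ := ih
    obtain ⟨N, hN⟩ := eventually_atTop.1 h
    refine ⟨1, one_pos, ?_⟩
    have key : ∀ m, poleCoeff (d + 2) p N + m * c ≤ poleCoeff (d + 2) p (N + m) := by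
      intro m
      induction m with
      | zero => simp
      | succ m ihm =>
        have := hN (N + (m + 1)) (by omega)
        rw [← add_assoc, poleCoeff_succ (d + 1) p (N + m + 1), Finset.sum_range_succ, ← poleCoeff_succ]
        push_cast
        rw [← add_assoc] at this
        linarith
    have ht : Tendsto (fun m : ℕ => poleCoeff (d + 2) p N + m * c) atTop atTop :=
      tendsto_atTop_add_const_left _ _ (tendsto_natCast_atTop_atTop.atTop_mul_const hc)
    obtain ⟨M, hM⟩ := eventually_atTop.1 (ht.eventually_ge_atTop 1)
    filter_upwards [eventually_ge_atTop (N + M)] with n hn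
    obtain ⟨m, rfl⟩ := Nat.exists_eq_add_of_le (le_trans (Nat.le_add_right N M) hn)
    exact (hM m (by omega)).trans (key m)

/-- If a polynomial takes nonnegative values arbitrarily close to `1` from below, then the
coefficients of its quotient by a power of `1 - x` are eventually nonnegative. -/
theorem eventually_poleCoeff_nonneg (d : ℕ) (p : ℝ[X])
    (hp : ∃ᶠ β in 𝓝[<] (1 : ℝ), 0 ≤ p.eval β) :
    ∀ᶠ n in atTop, 0 ≤ poleCoeff d p n := by
  induction d generalizing p with
  | zero => exact (eventually_poleCoeff_zero p).mono fun n hn => hn.ge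
  | succ d ih =>
    rcases lt_trichotomy (p.eval 1) 0 with h | h | h
    · exfalso
      refine hp ?_
      have : ∀ᶠ β in 𝓝[<] (1 : ℝ), p.eval β < 0 :=
        (p.continuous.tendsto 1).mono_left nhdsWithin_le_nhds |>.eventually_lt_const h
      exact this.mono fun β hβ => not_le.2 hβ
    -- A zero of `p` at `1` cancels one factor of the denominator; the cofactor `-q` has the sign of
    -- `p` below `1`, so induction on the pole order applies.
    · obtain ⟨q, rfl⟩ := Polynomial.dvd_iff_isRoot.2 h
      have hq : (Polynomial.X - Polynomial.C 1) * q = (1 - Polynomial.X) * (-q) := by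
        rw [Polynomial.C_1]; ring
      rw [hq] at hp ⊢
      simp only [poleCoeff_succ_one_sub_X_mul]
      refine ih _ ((hp.and_eventually self_mem_nhdsWithin).mono fun β hβ => ?_)
      obtain ⟨h1, h2⟩ := hβ
      rw [Polynomial.eval_mul] at h1
      have h2' : (β : ℝ) < 1 := h2
      refine (mul_nonneg_iff_of_pos_left ?_).1 h1
      simpa using h2'
    · obtain ⟨c, hc, h⟩ := exists_eventually_le_poleCoeff d p h
      exact h.mono fun n hn => hc.le.trans hn

theorem exists_tendsto_coe_eval_div (p : ℝ[X]) :
    ∃ l : EReal, Tendsto (fun n : ℕ => ((p.eval (n : ℝ) / ((n : ℝ) + 1) : ℝ) : EReal))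
      atTop (𝓝 l) := by
  have hQ : (Polynomial.X + Polynomial.C (1 : ℝ)) ≠ 0 := Polynomial.X_add_C_ne_zero 1
  have key : ∀ n : ℕ, p.eval (n : ℝ) / ((n : ℝ) + 1) =
      p.eval (n : ℝ) / (Polynomial.X + Polynomial.C (1 : ℝ)).eval (n : ℝ) := by simp
  simp only [key]
  have hn : Tendsto (fun n : ℕ => (n : ℝ)) atTop atTop := tendsto_natCast_atTop_atTop
  rcases lt_trichotomy p.degree (Polynomial.X + Polynomial.C (1 : ℝ)).degree with h | h | h
  · exact ⟨_, (continuous_coe_real_ereal.tendsto _).comp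
      ((p.div_tendsto_atTop_zero_of_degree_lt _ h).comp hn)⟩
  · exact ⟨_, (continuous_coe_real_ereal.tendsto _).comp
      ((p.div_tendsto_atTop_leadingCoeff_div_of_degree_eq _ h).comp hn)⟩
  · rcases le_total 0 (p.leadingCoeff / (Polynomial.X + Polynomial.C (1 : ℝ)).leadingCoeff)
      with h' | h'
    · exact ⟨⊤, EReal.tendsto_coe_nhds_top_iff.2
        ((p.div_tendsto_atTop_of_degree_gt _ h hQ h').comp hn)⟩
    · exact ⟨⊥, EReal.tendsto_coe_nhds_bot_iff.2
        ((p.div_tendsto_atBot_of_degree_gt _ h hQ h').comp hn)⟩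

/-- The coefficients agree beyond the degree of `p` with the values of its Hilbert polynomial, and a
quotient of polynomials always has a limit in the extended reals. -/
theorem exists_tendsto_poleCoeff_div (d : ℕ) (p : ℝ[X]) :
    ∃ l : EReal, Tendsto (fun n : ℕ => ((poleCoeff d p n / ((n : ℝ) + 1) : ℝ) : EReal))
      atTop (𝓝 l) := by
  obtain ⟨l, hl⟩ := exists_tendsto_coe_eval_div (Polynomial.hilbertPoly p d)
  refine ⟨l, hl.congr' ?_⟩
  filter_upwards [eventually_gt_atTop p.natDegree] with n hn
  rw [← Polynomial.coeff_mul_invOneSubPow_eq_hilbertPoly_eval d hn]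
  congr 4
  rcases d with _ | d
  · simp [PowerSeries.invOneSubPow_zero]
  · rw [PowerSeries.invOneSubPow_val_succ_eq_mk_add_choose,
      PowerSeries.mk_one_pow_eq_mk_choose_add]

/-! ### Iterated moments as weighted sums -/

theorem mk_moment (a : ℕ → ℝ) :
    PowerSeries.mk (moment a) = PowerSeries.mk a * (PowerSeries.mk 1 : ℝ⟦X⟧) := by
  ext n
  rw [coeff_mul_mk_one]
  simp [moment]

theorem mk_moment_iterate (k : ℕ) (a : ℕ → ℝ) :
    PowerSeries.mk (moment^[k] a) = PowerSeries.mk a * (PowerSeries.mk 1 : ℝ⟦X⟧) ^ k := by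
  induction k with
  | zero => simp
  | succ k ih => rw [Function.iterate_succ_apply', mk_moment, ih, pow_succ, mul_assoc]

theorem moment_iterate_succ_apply (k : ℕ) (a : ℕ → ℝ) (n : ℕ) :
    moment^[k + 1] a n =
      ∑ i ∈ Finset.range (n + 1), (((n - i) + k).choose k : ℝ) * a i := by
  have := congrArg (PowerSeries.coeff n) (mk_moment_iterate (k + 1) a)
  rw [PowerSeries.coeff_mk] at this
  rw [this, PowerSeries.mk_one_pow_eq_mk_choose_add, PowerSeries.coeff_mul,
    Finset.Nat.sum_antidiagonal_eq_sum_range_succ_mk]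
  simp [mul_comm, add_comm]

theorem momentAverage_succ (k : ℕ) (a : ℕ → ℝ) (n : ℕ) :
    momentAverage k a (n + 1) = moment^[k + 1] a n / ((n : ℝ) + 1) := by
  rw [Function.iterate_succ_apply', momentAverage, moment]
  push_cast
  rfl

/-! ### The discounted game for discount factors near `1` -/

namespace BWGame

variable {V : Type*}

/-- The best value of `f` on `s` for the player `p`. -/
noncomputable def bestValue (p : Player) (s : Finset V) (hs : s.Nonempty) (f : V → ℝ) : ℝ :=
  match p with
  | .min => s.inf' hs f
  | .max => s.sup' hs f

theorem bestValue_le_add (p : Player) {s : Finset V} (hs : s.Nonempty) {f g : V → ℝ} {c : ℝ}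
    (h : ∀ u ∈ s, f u ≤ g u + c) : bestValue p s hs f ≤ bestValue p s hs g + c := by
  cases p with
  | min =>
    obtain ⟨u, hu, he⟩ := s.exists_mem_eq_inf' hs g
    simp only [bestValue, he]
    exact (Finset.inf'_le f hu).trans (h u hu)
  | max =>
    obtain ⟨u, hu, he⟩ := s.exists_mem_eq_sup' hs f
    simp only [bestValue, he]
    exact (h u hu).trans (by gcongr; exact Finset.le_sup' g hu)

theorem exists_bestValue_eq (p : Player) {s : Finset V} (hs : s.Nonempty) (f : V → ℝ) :
    ∃ u ∈ s, bestValue p s hs f = f u := by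
  cases p with
  | min => exact s.exists_mem_eq_inf' hs f
  | max => exact s.exists_mem_eq_sup' hs f

/-- `σ` selects at each position an arc that is optimal in the `β`-discounted game, where `val`
is the vector of values. -/
structure IsDiscountedOptimal (G : BWGame V) (β : ℝ) (σ : V → V) (val : V → ℝ) : Prop where
  adj : ∀ v, G.graph.Adj v (σ v)
  eq : ∀ v, val v = G.reward v (σ v) + β * val (σ v)
  le : ∀ v u, G.graph.Adj v u → G.owner v = .max → G.reward v u + β * val u ≤ val v
  ge : ∀ v u, G.graph.Adj v u → G.owner v = .min → val v ≤ G.reward v u + β * val u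

/-- Shapley's argument: the Bellman operator is a `β`-contraction in the sup metric, and `σ` picks
an arc attaining the optimum at its fixed point. -/
theorem exists_isDiscountedOptimal [Fintype V] (G : BWGame V) {β : ℝ} (h0 : 0 ≤ β) (h1 : β < 1) :
    ∃ σ val, G.IsDiscountedOptimal β σ val := by
  classical
  let N : V → Finset V := fun v => Finset.univ.filter fun u => G.graph.Adj v u
  have hN : ∀ v, (N v).Nonempty := fun v => by
    obtain ⟨u, hu⟩ := G.exists_adj v
    exact ⟨u, by simpa [N] using hu⟩
  let T : (V → ℝ) → V → ℝ := fun f v =>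
    bestValue (G.owner v) (N v) (hN v) fun u => G.reward v u + β * f u
  have hT : ∀ f g v, T f v ≤ T g v + β * dist f g := fun f g v => by
    refine bestValue_le_add _ _ fun u _ => ?_
    have h := (le_abs_self _).trans ((Real.dist_eq _ _).symm.le.trans (dist_le_pi_dist f g u))
    nlinarith [mul_le_mul_of_nonneg_left h h0]
  have hc : ContractingWith ⟨β, h0⟩ T := by
    refine ⟨h1, LipschitzWith.of_dist_le_mul fun f g => ?_⟩
    refine (dist_pi_le_iff (mul_nonneg h0 dist_nonneg)).2 fun v => ?_
    rw [Real.dist_eq, abs_le]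
    have h1 := hT f g v
    have h2 := hT g f v
    rw [dist_comm] at h2
    change -(β * dist f g) ≤ _ ∧ _ ≤ β * dist f g
    constructor <;> linarith
  have hfix : T (ContractingWith.fixedPoint T hc) = ContractingWith.fixedPoint T hc :=
    hc.fixedPoint_isFixedPt
  generalize ContractingWith.fixedPoint T hc = val at hfix
  choose σ hσ hσ' using fun v => exists_bestValue_eq (G.owner v) (hN v)
    fun u => G.reward v u + β * val u
  refine ⟨σ, val, fun v => by simpa [N] using hσ v, fun v => ?_, fun v u hu hv => ?_,
    fun v u hu hv => ?_⟩
  · rw [← hσ' v]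
    exact (congrFun hfix v).symm
  · rw [← congrFun hfix v]
    simp only [T, hv, bestValue]
    exact Finset.le_sup' (fun u => G.reward v u + β * val u) (by simpa [N] using hu)
  · rw [← congrFun hfix v]
    simp only [T, hv, bestValue]
    exact Finset.inf'_le (fun u => G.reward v u + β * val u) (by simpa [N] using hu)

/-- Pigeonhole: if each of the finitely many `σ` failed for all `β` near `1`, some `β` would have no
optimal selection at all. -/
theorem exists_frequently_isDiscountedOptimal [Fintype V] (G : BWGame V) :
    ∃ σ, ∃ᶠ β in 𝓝[<] (1 : ℝ), ∃ val, G.IsDiscountedOptimal β σ val := by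
  by_contra! h
  have h' := eventually_all.2 h
  have h0 : ∀ᶠ β in 𝓝[<] (1 : ℝ), 0 ≤ β :=
    (eventually_ge_nhds one_pos).filter_mono nhdsWithin_le_nhds
  obtain ⟨β, hβ, hβ0, hβ1⟩ := (h'.and (h0.and self_mem_nhdsWithin)).exists
  obtain ⟨σ, val, hσ⟩ := G.exists_isDiscountedOptimal hβ0 hβ1
  exact hβ σ val hσ

/-- The polynomial in the discount factor that gives the discounted reward of the first `n` moves
of the play along `σ`. -/
noncomputable def discountedSum (G : BWGame V) (σ : V → V) (n : ℕ) (v : V) : ℝ[X] :=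
  ∑ t ∈ Finset.range n,
    Polynomial.C (G.reward (σ^[t] v) (σ (σ^[t] v))) * Polynomial.X ^ t

theorem IsDiscountedOptimal.eq_discountedSum {G : BWGame V} {β : ℝ} {σ : V → V} {val : V → ℝ}
    (h : G.IsDiscountedOptimal β σ val) (n : ℕ) (v : V) :
    val v = (G.discountedSum σ n v).eval β + β ^ n * val (σ^[n] v) := by
  induction n with
  | zero => simp [discountedSum]
  | succ n ih =>
    have := h.eq (σ^[n] v)
    rw [ih, discountedSum, discountedSum, Finset.sum_range_succ, Polynomial.eval_add,
      Function.iterate_succ_apply', this]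
    simp
    ring

theorem exists_iterate_add_eq [Finite V] (σ : V → V) :
    ∃ m L, 0 < L ∧ σ^[m + L] = σ^[m] := by
  obtain ⟨i, j, hij, h⟩ := Finite.exists_ne_map_eq_of_infinite fun n : ℕ => σ^[n]
  rcases lt_or_gt_of_ne hij with hlt | hlt
  · exact ⟨i, j - i, by omega, by rw [Nat.add_sub_cancel' hlt.le]; exact h.symm⟩
  · exact ⟨j, i - j, by omega, by rw [Nat.add_sub_cancel' hlt.le]; exact h⟩

/-- After `m` moves along `σ` the play has period `L` from every start, so its discounted reward is
a finite sum plus a geometric series of ratio `β ^ L`. -/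
theorem exists_polynomial_discountedValue [Finite V] (G : BWGame V) (σ : V → V) :
    ∃ L > 0, ∃ p : V → ℝ[X], ∀ β val, G.IsDiscountedOptimal β σ val →
      ∀ v, (1 - β ^ L) * val v = (p v).eval β := by
  obtain ⟨m, L, hL, h⟩ := exists_iterate_add_eq σ
  refine ⟨L, hL, fun v => (1 - Polynomial.X ^ L) * G.discountedSum σ m v +
    Polynomial.X ^ m * G.discountedSum σ L (σ^[m] v), fun β val hval v => ?_⟩
  have h1 := hval.eq_discountedSum m v
  have h2 := hval.eq_discountedSum L (σ^[m] v)
  rw [← Function.iterate_add_apply, add_comm L m, h] at h2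
  simp only [Polynomial.eval_add, Polynomial.eval_mul, Polynomial.eval_sub, Polynomial.eval_one,
    Polynomial.eval_pow, Polynomial.eval_X]
  linear_combination (1 - β ^ L) * h1 + β ^ m * h2

/-! ### From discounted values to finite horizon potentials -/

/-- The geometric sum takes the value `L ≠ 0` at `1`, hence is coprime to `1 - X`. Positivity of `a`
at `1` ensures that multiplication by `a` preserves signs near `1`. -/
theorem exists_inverse_geom_sum {L : ℕ} (hL : 0 < L) (d : ℕ) :
    ∃ a b : ℝ[X], 0 < a.eval 1 ∧
      a * ∑ i ∈ Finset.range L, Polynomial.X ^ i + b * (1 - Polynomial.X) ^ (d + 1) = 1 := by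
  set g : ℝ[X] := ∑ i ∈ Finset.range L, Polynomial.X ^ i with hg
  have hg1 : g.eval 1 = L := by simp [hg, Polynomial.eval_finsetSum]
  have hL' : (0 : ℝ) < L := by exact_mod_cast hL
  obtain ⟨q, hq⟩ : Polynomial.X - Polynomial.C 1 ∣ g - Polynomial.C (L : ℝ) := by
    rw [Polynomial.dvd_iff_isRoot]
    simp [hg1]
  have hc : IsCoprime g (1 - Polynomial.X) := by
    refine ⟨Polynomial.C (L : ℝ)⁻¹, Polynomial.C (L : ℝ)⁻¹ * q, ?_⟩
    have : Polynomial.C (L : ℝ)⁻¹ * Polynomial.C (L : ℝ) = 1 := by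
      rw [← Polynomial.C_mul, inv_mul_cancel₀ hL'.ne', Polynomial.C_1]
    rw [Polynomial.C_1] at hq
    linear_combination this + Polynomial.C (L : ℝ)⁻¹ * hq
  obtain ⟨a, b, hab⟩ := hc.pow_right (n := d + 1)
  refine ⟨a, b, ?_, hab⟩
  have := congrArg (Polynomial.eval 1) hab
  simp [hg1] at this
  exact pos_of_mul_pos_left (this.symm ▸ one_pos : 0 < a.eval 1 * L) hL'.le

/-- Functions `F` that asymptotically satisfy the optimality equations of the finite horizon
games in which the reward of a move is weighted with `((n + 1) + k).choose k`, if `n` moves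
follow the next one. The map `σ` selects an optimal arc at each position. -/
structure IsHorizonOptimal (G : BWGame V) (k : ℕ) (σ : V → V) (F : ℕ → V → ℝ) (n : ℕ) :
    Prop where
  eq : ∀ v, F (n + 1) v = ((n + 1 + k).choose k : ℝ) * G.reward v (σ v) + F n (σ v)
  le : ∀ v u, G.graph.Adj v u → G.owner v = .max →
    ((n + 1 + k).choose k : ℝ) * G.reward v u + F n u ≤ F (n + 1) v
  ge : ∀ v u, G.graph.Adj v u → G.owner v = .min →
    F (n + 1) v ≤ ((n + 1 + k).choose k : ℝ) * G.reward v u + F n u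

theorem exists_isHorizonOptimal [Fintype V] (G : BWGame V) (k : ℕ) :
    ∃ (σ : V → V) (F : ℕ → V → ℝ), (∀ v, G.graph.Adj v (σ v)) ∧
      (∀ v, ∃ l : EReal,
        Tendsto (fun n : ℕ => ((F n v / ((n : ℝ) + 1) : ℝ) : EReal)) atTop (𝓝 l)) ∧
      ∀ᶠ n in atTop, G.IsHorizonOptimal k σ F n := by
  obtain ⟨σ, hσ⟩ := G.exists_frequently_isDiscountedOptimal
  obtain ⟨L, hL, p, hp⟩ := G.exists_polynomial_discountedValue σ
  obtain ⟨a, b, ha, hab⟩ := exists_inverse_geom_sum hL (k + 1)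
  have ha' : ∀ᶠ β in 𝓝[<] (1 : ℝ), 0 < β ∧ β < 1 ∧ 0 < a.eval β :=
    ((eventually_gt_nhds one_pos).filter_mono nhdsWithin_le_nhds).and
      (Eventually.and self_mem_nhdsWithin
      (((a.continuous.tendsto 1).mono_left nhdsWithin_le_nhds).eventually_const_lt ha))
  have hg := mul_neg_geom_sum (Polynomial.X : ℝ[X]) L
  let q : V → V → ℝ[X] := fun v u =>
    a * (p v - (1 - Polynomial.X ^ L) * Polynomial.C (G.reward v u) - Polynomial.X * p u)
  have hq : ∀ β val, G.IsDiscountedOptimal β σ val → ∀ v u, (q v u).eval β =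
      a.eval β * ((1 - β ^ L) * (val v - (G.reward v u + β * val u))) := by
    intro β val h v u
    simp only [q, Polynomial.eval_mul, Polynomial.eval_sub, Polynomial.eval_one,
      Polynomial.eval_pow, Polynomial.eval_X, Polynomial.eval_C, ← hp β val h]
    ring
  -- For these `β` the polynomial `q v u` has the sign of the Bellman defect of the arc,
  -- simultaneously for all pairs `v`, `u`.
  have hval : ∃ᶠ β in 𝓝[<] (1 : ℝ), ∃ val, G.IsDiscountedOptimal β σ val ∧ ∀ v u,
      ∃ c > 0, (q v u).eval β = c * (val v - (G.reward v u + β * val u)) := by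
    refine (hσ.and_eventually ha').mono ?_
    rintro β ⟨⟨val, h⟩, h0, h1, h2⟩
    refine ⟨val, h, fun v u => ⟨a.eval β * (1 - β ^ L), ?_, ?_⟩⟩
    · exact mul_pos h2 (sub_pos.2 (pow_lt_one₀ h0.le h1 hL.ne'))
    · rw [hq β val h, mul_assoc]
  -- The pole order is `k + 2`: one factor from the denominator of the value, and `k + 1` from the
  -- weights.
  let F : ℕ → V → ℝ := fun n v => poleCoeff (k + 2) (a * p v) n
  have hF : ∀ v u, ∀ᶠ n in atTop, poleCoeff (k + 2) (q v u) (n + 1) =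
      F (n + 1) v - (((n + 1 + k).choose k : ℝ) * G.reward v u + F n u) := by
    intro v u
    -- Replacing `a * (1 - X ^ L)` by `1 - X` costs a multiple of `(1 - X) ^ (k + 2)`; over the pole
    -- this is a polynomial, without coefficients at large indices.
    have e : q v u = a * p v - (1 - Polynomial.X) * Polynomial.C (G.reward v u) -
        Polynomial.X * (a * p u) - (1 - Polynomial.X) ^ (k + 2) *
          -(b * (1 - Polynomial.X) * Polynomial.C (G.reward v u)) := by
      simp only [q]
      linear_combination a * Polynomial.C (G.reward v u) * hg +
        (Polynomial.X - 1) * Polynomial.C (G.reward v u) * hab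
    have h0 := tendsto_add_atTop_nat 1 |>.eventually (eventually_poleCoeff_zero
      (-(b * (1 - Polynomial.X) * Polynomial.C (G.reward v u))))
    filter_upwards [h0] with n hn
    have h1 := poleCoeff_add_one_sub_X_pow_mul 0 (k + 2)
      (-(b * (1 - Polynomial.X) * Polynomial.C (G.reward v u))) (n + 1)
    rw [zero_add, hn] at h1
    rw [e, poleCoeff_sub, h1, poleCoeff_sub, poleCoeff_sub, poleCoeff_X_mul,
      poleCoeff_succ_one_sub_X_mul, poleCoeff_C]
    ring
  have hle : ∀ v u, (∃ᶠ β in 𝓝[<] (1 : ℝ), 0 ≤ (q v u).eval β) → ∀ᶠ n in atTop,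
      ((n + 1 + k).choose k : ℝ) * G.reward v u + F n u ≤ F (n + 1) v := by
    intro v u h
    filter_upwards [hF v u, tendsto_add_atTop_nat 1 |>.eventually
      (eventually_poleCoeff_nonneg (k + 2) _ h)] with n h1 h2
    linarith
  have hge : ∀ v u, (∃ᶠ β in 𝓝[<] (1 : ℝ), (q v u).eval β ≤ 0) → ∀ᶠ n in atTop,
      F (n + 1) v ≤ ((n + 1 + k).choose k : ℝ) * G.reward v u + F n u := by
    intro v u h
    have h' : ∃ᶠ β in 𝓝[<] (1 : ℝ), 0 ≤ (0 - q v u).eval β := h.mono fun β hβ => by simpa using hβ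
    filter_upwards [hF v u, tendsto_add_atTop_nat 1 |>.eventually
      (eventually_poleCoeff_nonneg (k + 2) _ h'),
      tendsto_add_atTop_nat 1 |>.eventually
      (eventually_poleCoeff_nonneg (k + 2) 0 (h.mono fun β hβ => by simp))] with n h1 h2 h3
    have h4 : poleCoeff (k + 2) 0 (n + 1) = 0 := by simp [poleCoeff]
    rw [poleCoeff_sub, h4] at h2
    linarith
  refine ⟨σ, F, ?_, fun v => exists_tendsto_poleCoeff_div _ _, ?_⟩
  · obtain ⟨β, val, h⟩ := hσ.exists
    exact h.adj
  have hσ_eq : ∀ v, ∀ᶠ n in atTop,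
      F (n + 1) v = ((n + 1 + k).choose k : ℝ) * G.reward v (σ v) + F n (σ v) := by
    intro v
    have h0 : ∃ᶠ β in 𝓝[<] (1 : ℝ), (q v (σ v)).eval β = 0 := hval.mono fun β h => by
      obtain ⟨val, h, h'⟩ := h
      obtain ⟨c, _, hc⟩ := h' v (σ v)
      rw [hc, ← h.eq, sub_self, mul_zero]
    filter_upwards [hle v _ (h0.mono fun β h => h.ge), hge v _ (h0.mono fun β h => h.le)]
      with n h1 h2 using le_antisymm h2 h1
  have hmax : ∀ v u, ∀ᶠ n in atTop, G.graph.Adj v u → G.owner v = .max →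
      ((n + 1 + k).choose k : ℝ) * G.reward v u + F n u ≤ F (n + 1) v := by
    intro v u
    simp only [eventually_imp_distrib_left]
    refine fun hu hv => hle v u (hval.mono fun β h => ?_)
    obtain ⟨val, h, h'⟩ := h
    obtain ⟨c, hc, he⟩ := h' v u
    rw [he]
    exact mul_nonneg hc.le (sub_nonneg.2 (h.le v u hu hv))
  have hmin : ∀ v u, ∀ᶠ n in atTop, G.graph.Adj v u → G.owner v = .min →
      F (n + 1) v ≤ ((n + 1 + k).choose k : ℝ) * G.reward v u + F n u := by
    intro v u
    simp only [eventually_imp_distrib_left]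
    refine fun hu hv => hge v u (hval.mono fun β h => ?_)
    obtain ⟨val, h, h'⟩ := h
    obtain ⟨c, hc, he⟩ := h' v u
    rw [he]
    exact mul_nonpos_of_nonneg_of_nonpos hc.le (sub_nonpos.2 (h.ge v u hu hv))
  filter_upwards [eventually_all.2 hσ_eq, eventually_all.2 fun v => eventually_all.2 (hmax v),
    eventually_all.2 fun v => eventually_all.2 (hmin v)] with n h1 h2 h3 using ⟨h1, h2, h3⟩

end BWGame

/-! ### Expectations and the telescoping of potentials -/

theorem PMF.sum_toReal {α : Type*} [Fintype α] (p : PMF α) : ∑ x, (p x).toReal = 1 := by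
  rw [← ENNReal.toReal_sum fun x _ => p.apply_ne_top x, ← tsum_fintype (L := .unconditional _),
    p.tsum_coe, ENNReal.toReal_one]

theorem PMF.sum_map_toReal_mul {α β : Type*} [Fintype α] [Fintype β] (p : PMF α) (f : α → β)
    (g : β → ℝ) : ∑ y, ((p.map f) y).toReal * g y = ∑ x, (p x).toReal * g (f x) := by
  classical
  have h : ∀ y, ((p.map f) y).toReal = ∑ x, if y = f x then (p x).toReal else 0 := fun y => by
    rw [PMF.map_apply, tsum_fintype, ENNReal.toReal_sum]
    · refine Finset.sum_congr rfl fun x _ => ?_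
      split_ifs <;> simp
    · intro x _
      split_ifs
      · exact p.apply_ne_top x
      · simp
  simp only [h, Finset.sum_mul]
  rw [Finset.sum_comm]
  simp

theorem PMF.sum_toReal_mul_le {α : Type*} [Fintype α] (p : PMF α) {f g : α → ℝ}
    (h : ∀ x ∈ p.support, f x ≤ g x) : ∑ x, (p x).toReal * f x ≤ ∑ x, (p x).toReal * g x := by
  refine Finset.sum_le_sum fun x _ => ?_
  by_cases hx : p x = 0
  · simp [hx]
  · exact mul_le_mul_of_nonneg_left (h x ((p.mem_support_iff x).2 hx)) ENNReal.toReal_nonneg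

theorem PMF.abs_sum_toReal_mul_le {α : Type*} [Fintype α] (p : PMF α) {f : α → ℝ} {B : ℝ}
    (h : ∀ x, |f x| ≤ B) : |∑ x, (p x).toReal * f x| ≤ B := by
  have hB : ∑ x, (p x).toReal * B = B := by rw [← Finset.sum_mul, p.sum_toReal, one_mul]
  have hB' : ∑ x, (p x).toReal * -B = -B := by rw [← Finset.sum_mul, p.sum_toReal, one_mul]
  rw [abs_le]
  constructor
  · rw [← hB']
    exact p.sum_toReal_mul_le fun x _ => (abs_le.1 (h x)).1
  · conv_rhs => rw [← hB]
    exact p.sum_toReal_mul_le fun x _ => (abs_le.1 (h x)).2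

/-- Here `e t n` is the potential at time `t` with horizon `n`. The induction on the horizon splits
off the first move and restarts at `t + 1`, so the error `C` enters only once, at horizon `N`. -/
theorem weighted_sum_le {c a : ℕ → ℝ} {e : ℕ → ℕ → ℝ} {C : ℝ} {N : ℕ}
    (hstep : ∀ n ≥ N, ∀ t, c (n + 1) * a t + e (t + 1) n ≤ e t (n + 1))
    (h0 : ∀ t, ∑ i ∈ Finset.range (N + 1), c (N - i) * a (t + i) ≤ e t N + C) (j t : ℕ) :
    ∑ i ∈ Finset.range (N + j + 1), c (N + j - i) * a (t + i) ≤ e t (N + j) + C := by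
  induction j generalizing t with
  | zero => exact h0 t
  | succ j ih =>
    rw [Finset.sum_range_succ', Nat.sub_zero, ← add_assoc]
    have h1 := ih (t + 1)
    have h2 := hstep (N + j) (by omega) t
    have h3 : ∀ i, c (N + j + 1 - (i + 1)) * a (t + (i + 1)) =
        c (N + j - i) * a (t + 1 + i) := fun i => by
      congr 2
      · omega
      · ring
    simp only [h3, add_zero]
    linarith

/-! ### Plays restricted to a set of arcs -/

namespace BWGame

variable {V : Type*} {G : BWGame V}

theorem mem_support_step {b : G.Strategy .min} {w : G.Strategy .max} {t : ℕ}
    {h : Fin (t + 1) → V} {u : V} (hu : u ∈ (step b w t h).support) :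
    (∃ hp, u ∈ (b.move t h hp).support) ∨ ∃ hp, u ∈ (w.move t h hp).support := by
  unfold step at hu
  split at hu
  · exact .inl ⟨_, hu⟩
  · exact .inr ⟨_, hu⟩

/-- All moves of the two strategies go along arcs in `A`. -/
def Conforms (b : G.Strategy .min) (w : G.Strategy .max) (A : V → V → Prop) : Prop :=
  ∀ t (h : Fin (t + 1) → V), ∀ u ∈ (step b w t h).support, A (h (Fin.last t)) u

theorem Conforms.of_mem_support {b : G.Strategy .min} {w : G.Strategy .max} {A : V → V → Prop}
    (hA : Conforms b w A) {v₀ : V} {t : ℕ} {h : Fin (t + 2) → V}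
    (hh : h ∈ (historyLaw b w v₀ (t + 1)).support) :
    A (h (Fin.last t).castSucc) (h (Fin.last (t + 1))) := by
  rw [historyLaw, PMF.mem_support_bind_iff] at hh
  obtain ⟨h', _, hh⟩ := hh
  rw [PMF.mem_support_map_iff] at hh
  obtain ⟨u, hu, rfl⟩ := hh
  rw [Fin.snoc_castSucc, Fin.snoc_last]
  exact hA t h' u hu

/-- Consistency of the laws puts expectations at times `t` and `t + 1` over one probability space.
-/
theorem historyLaw_map_init (b : G.Strategy .min) (w : G.Strategy .max) (v₀ : V) (t : ℕ) :
    (historyLaw b w v₀ (t + 1)).map (fun h i => h i.castSucc) = historyLaw b w v₀ t := by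
  rw [historyLaw, PMF.map_bind]
  have : ∀ h : Fin (t + 1) → V, ((step b w t h).map fun u => (Fin.snoc h u : Fin (t + 2) → V)).map
      (fun h i => h i.castSucc) = PMF.pure h := fun h => by
    rw [PMF.map_comp, ← PMF.map_const (step b w t h)]
    congr 1
    funext u i
    simp
  simp only [this, PMF.bind_pure]

theorem Conforms.of_moves {b : G.Strategy .min} {w : G.Strategy .max} {A : V → V → Prop}
    (hb : ∀ t (h : Fin (t + 1) → V) hp, ∀ u ∈ (b.move t h hp).support, A (h (Fin.last t)) u)
    (hw : ∀ t (h : Fin (t + 1) → V) hp, ∀ u ∈ (w.move t h hp).support, A (h (Fin.last t)) u) :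
    Conforms b w A := by
  intro t h u hu
  rcases mem_support_step hu with ⟨hp, hu⟩ | ⟨hp, hu⟩
  · exact hb t h hp u hu
  · exact hw t h hp u hu

theorem PureStationary.eq_next_of_mem_support {p : Player} {π : G.PureStationary p} {t : ℕ}
    {h : Fin (t + 1) → V} {hp : G.owner (h (Fin.last t)) = p} {u : V}
    (hu : u ∈ (π.toStrategy.move t h hp).support) : u = π.next _ hp := by
  rwa [PureStationary.toStrategy, PMF.support_pure, Set.mem_singleton_iff] at hu

/-- The arcs that are left when the player `p` is bound to the pure stationary strategy `π`. -/
def PureStationary.Allows {p : Player} (π : G.PureStationary p) (v u : V) : Prop :=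
  G.graph.Adj v u ∧ ∀ hv : G.owner v = p, u = π.next v hv

/-- The game in which the player `p` is bound to the pure stationary strategy `π`. -/
def PureStationary.boundGame {p : Player} (π : G.PureStationary p) : BWGame V where
  graph := ⟨π.Allows⟩
  owner := G.owner
  exists_adj v := by
    by_cases hv : G.owner v = p
    · exact ⟨π.next v hv, π.adj v hv, fun _ => rfl⟩
    · obtain ⟨u, hu⟩ := G.exists_adj v
      exact ⟨u, hu, fun h => absurd h hv⟩
  reward := G.reward

theorem conforms_toStrategy_min (b : G.PureStationary .min) (w : G.Strategy .max) :
    Conforms b.toStrategy w b.Allows :=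
  .of_moves (fun _ _ _ _ hu => ⟨Strategy.adj _ _ _ _ _ hu, fun _ =>
      PureStationary.eq_next_of_mem_support hu⟩)
    fun t h hp u hu => ⟨w.adj t h hp u hu, fun h => by simp [hp] at h⟩

theorem conforms_toStrategy_max (b : G.Strategy .min) (w : G.PureStationary .max) :
    Conforms b w.toStrategy w.Allows :=
  .of_moves (fun t h hp u hu => ⟨b.adj t h hp u hu, fun h => by simp [hp] at h⟩)
    fun _ _ _ _ hu => ⟨Strategy.adj _ _ _ _ _ hu, fun _ =>
      PureStationary.eq_next_of_mem_support hu⟩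

theorem conforms_toStrategy_toStrategy {b : G.PureStationary .min} {w : G.PureStationary .max}
    {σ : V → V} (hb : ∀ v hv, b.next v hv = σ v) (hw : ∀ v hv, w.next v hv = σ v) :
    Conforms b.toStrategy w.toStrategy fun v u => u = σ v :=
  .of_moves (fun _ _ hp _ hu => (PureStationary.eq_next_of_mem_support hu).trans (hb _ hp))
    fun _ _ hp _ hu => (PureStationary.eq_next_of_mem_support hu).trans (hw _ hp)

/-- At positions of the minimizer only the arc of `σ` is left, where equality holds; at the others
the optimality of `F` applies. -/
theorem IsHorizonOptimal.le_of_allows {k : ℕ} {σ : V → V} {F : ℕ → V → ℝ} {n : ℕ}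
    (h : G.IsHorizonOptimal k σ F n) {b : G.PureStationary .min}
    (hb : ∀ v hv, b.next v hv = σ v) (v u : V) (hvu : b.Allows v u) :
    ((n + 1 + k).choose k : ℝ) * G.reward v u + F n u ≤ F (n + 1) v := by
  cases hv : G.owner v with
  | min =>
    rw [hvu.2 hv, hb]
    exact (h.eq v).ge
  | max => exact h.le v u hvu.1 hv

theorem IsHorizonOptimal.ge_of_allows {k : ℕ} {σ : V → V} {F : ℕ → V → ℝ} {n : ℕ}
    (h : G.IsHorizonOptimal k σ F n) {w : G.PureStationary .max}
    (hw : ∀ v hv, w.next v hv = σ v) (v u : V) (hvu : w.Allows v u) :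
    F (n + 1) v ≤ ((n + 1 + k).choose k : ℝ) * G.reward v u + F n u := by
  cases hv : G.owner v with
  | max =>
    rw [hvu.2 hv, hw]
    exact (h.eq v).le
  | min => exact h.ge v u hvu.1 hv

/-! ### Expected potentials along a play -/

variable [Fintype V]

/-- The expectation of `f (s_t)`. -/
noncomputable def expectedValue (b : G.Strategy .min) (w : G.Strategy .max) (v₀ : V) (t : ℕ)
    (f : V → ℝ) : ℝ :=
  ∑ h : Fin (t + 1) → V, (historyLaw b w v₀ t h).toReal * f (h (Fin.last t))

theorem expectedValue_zero (b : G.Strategy .min) (w : G.Strategy .max) (v₀ : V) (f : V → ℝ) :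
    expectedValue b w v₀ 0 f = f v₀ := by
  classical
  rw [expectedValue, Finset.sum_eq_single fun _ => v₀]
  · simp [historyLaw]
  · intro h _ hne
    simp [historyLaw, hne]
  · simp

theorem expectedValue_eq_sum_succ (b : G.Strategy .min) (w : G.Strategy .max) (v₀ : V) (t : ℕ)
    (f : V → ℝ) :
    expectedValue b w v₀ t f = ∑ h : Fin (t + 2) → V,
      (historyLaw b w v₀ (t + 1) h).toReal * f (h (Fin.last t).castSucc) := by
  rw [expectedValue, ← historyLaw_map_init, PMF.sum_map_toReal_mul]

theorem Conforms.add_expectedValue_le {b : G.Strategy .min} {w : G.Strategy .max}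
    {A : V → V → Prop} (hA : Conforms b w A) (v₀ : V) (t : ℕ) {c : ℝ} {f g : V → ℝ}
    (h : ∀ v u, A v u → c * G.reward v u + f u ≤ g v) :
    c * expectedRewards b w v₀ t + expectedValue b w v₀ (t + 1) f ≤ expectedValue b w v₀ t g := by
  rw [expectedValue_eq_sum_succ b w v₀ t g, expectedRewards, expectedValue, Finset.mul_sum,
    ← Finset.sum_add_distrib]
  refine le_trans (le_of_eq (Finset.sum_congr rfl fun x _ => ?_))
    ((historyLaw b w v₀ (t + 1)).sum_toReal_mul_le fun x hx => h _ _ (hA.of_mem_support hx))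
  ring

/-- A potential `F` that satisfies the optimality inequalities of the finite horizon games from
the horizon `N` on bounds the weighted sums of expected rewards up to a constant which does not
depend on the strategies. The factor `s` allows for both directions of the inequality. -/
theorem exists_moment_le_of_conforms (G : BWGame V) {k : ℕ} {A : V → V → Prop} (s : ℝ)
    {F : ℕ → V → ℝ} {N : ℕ}
    (hF : ∀ n ≥ N, ∀ v u, A v u →
      s * (((n + 1 + k).choose k : ℝ) * G.reward v u + F n u) ≤ s * F (n + 1) v) :
    ∃ C, ∀ (b : G.Strategy .min) (w : G.Strategy .max), Conforms b w A → ∀ v₀, ∀ n ≥ N,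
      s * moment^[k + 1] (expectedRewards b w v₀) n ≤ s * F n v₀ + C := by
  have hR : ∀ v u, |G.reward v u| ≤ ∑ v, ∑ u, |G.reward v u| := fun v u =>
    (Finset.single_le_sum (f := fun u => |G.reward v u|) (fun _ _ => abs_nonneg _)
      (Finset.mem_univ u)).trans
      (Finset.single_le_sum (f := fun v => ∑ u, |G.reward v u|)
        (fun _ _ => Finset.sum_nonneg fun _ _ => abs_nonneg _) (Finset.mem_univ v))
  have hB : ∀ v, |s * F N v| ≤ ∑ v, |s * F N v| := fun v =>
    Finset.single_le_sum (f := fun v => |s * F N v|) (fun _ _ => abs_nonneg _) (Finset.mem_univ v)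
  set R := ∑ v, ∑ u, |G.reward v u|
  set B := ∑ v, |s * F N v|
  -- At horizon `N` the weighted rewards and the potential are bounded crudely, by the absolute
  -- values `R` and `B` taken over all pairs of positions and over all positions.
  refine ⟨∑ i ∈ Finset.range (N + 1), ((N - i + k).choose k : ℝ) * (|s| * R) + B,
    fun b w hA v₀ n hn => ?_⟩
  obtain ⟨j, rfl⟩ := Nat.exists_eq_add_of_le hn
  have key := weighted_sum_le (N := N) (c := fun n => ((n + k).choose k : ℝ))
    (a := fun t => s * expectedRewards b w v₀ t)
    (e := fun t n => expectedValue b w v₀ t fun v => s * F n v)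
    (C := ∑ i ∈ Finset.range (N + 1), ((N - i + k).choose k : ℝ) * (|s| * R) + B) ?_ ?_ j 0
  · simp only [zero_add, expectedValue_zero] at key
    rw [moment_iterate_succ_apply, Finset.mul_sum]
    refine le_trans (le_of_eq (Finset.sum_congr rfl fun i _ => ?_)) key
    ring
  · intro n hn t
    rw [← mul_assoc]
    refine hA.add_expectedValue_le v₀ t fun v u huv => ?_
    have := hF n hn v u huv
    linarith
  · intro t
    have h1 : -B ≤ expectedValue b w v₀ t fun v => s * F N v :=
      (abs_le.1 (PMF.abs_sum_toReal_mul_le _ fun h => hB _)).1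
    have h2 : ∑ i ∈ Finset.range (N + 1),
        ((N - i + k).choose k : ℝ) * (s * expectedRewards b w v₀ (t + i)) ≤
        ∑ i ∈ Finset.range (N + 1), ((N - i + k).choose k : ℝ) * (|s| * R) := by
      refine Finset.sum_le_sum fun i _ => mul_le_mul_of_nonneg_left ?_ (Nat.cast_nonneg _)
      refine (le_abs_self _).trans ?_
      rw [abs_mul]
      exact mul_le_mul_of_nonneg_left (PMF.abs_sum_toReal_mul_le _ fun h => hR _ _) (abs_nonneg s)
    linarith

/-! ### Uniform bounds on the averages -/

theorem tendsto_coe_add_const_div {f : ℕ → ℝ} {l : EReal}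
    (hf : Tendsto (fun n : ℕ => ((f n / ((n : ℝ) + 1) : ℝ) : EReal)) atTop (𝓝 l)) (C : ℝ) :
    Tendsto (fun n : ℕ => (((f n + C) / ((n : ℝ) + 1) : ℝ) : EReal)) atTop (𝓝 l) := by
  have hC : Tendsto (fun n : ℕ => ((C / ((n : ℝ) + 1) : ℝ) : EReal)) atTop (𝓝 0) :=
    (continuous_coe_real_ereal.tendsto 0).comp
      (tendsto_const_nhds.div_atTop (tendsto_natCast_atTop_atTop.atTop_add tendsto_const_nhds))
  -- Addition is continuous at `(l, 0)` even for infinite `l`, as the second entry is finite.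
  have h := (EReal.continuousAt_add (p := (l, 0)) (by simp) (by simp)).tendsto.comp
    (hf.prodMk_nhds hC)
  simpa [Function.comp_def, add_div] using h

variable {k : ℕ} {A : V → V → Prop} {F : ℕ → V → ℝ} {v₀ : V} {l : EReal}

theorem exists_forall_momentAverage_le
    (hF : ∀ᶠ n in atTop, ∀ v u, A v u →
      ((n + 1 + k).choose k : ℝ) * G.reward v u + F n u ≤ F (n + 1) v)
    (hl : Tendsto (fun n : ℕ => ((F n v₀ / ((n : ℝ) + 1) : ℝ) : EReal)) atTop (𝓝 l))
    (x : ℝ) (hx : l < x) :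
    ∃ T₀ : ℕ, ∀ (b : G.Strategy .min) (w : G.Strategy .max), Conforms b w A → ∀ T ≥ T₀,
      momentAverage k (expectedRewards b w v₀) T ≤ x := by
  obtain ⟨N, hN⟩ := eventually_atTop.1 hF
  obtain ⟨C, hC⟩ := G.exists_moment_le_of_conforms (k := k) (A := A) 1 (F := F) (N := N)
    fun n hn v u h => by simpa using hN n hn v u h
  obtain ⟨M, hM⟩ := eventually_atTop.1 ((tendsto_coe_add_const_div hl C).eventually_lt_const hx)
  -- The summand `1` makes `T` positive, so that `T = n + 1`; neither `N`, `C` nor `M` depends on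
  -- the strategies.
  refine ⟨N + M + 1, fun b w hA T hT => ?_⟩
  obtain ⟨n, rfl⟩ := Nat.exists_eq_add_of_le' (le_trans (Nat.le_add_left 1 _) hT)
  have h1 := hC b w hA v₀ n (by omega)
  have h2 := EReal.coe_lt_coe_iff.1 (hM n (by omega))
  rw [one_mul, one_mul] at h1
  rw [momentAverage_succ]
  refine le_trans ?_ h2.le
  gcongr

theorem exists_forall_le_momentAverage
    (hF : ∀ᶠ n in atTop, ∀ v u, A v u →
      F (n + 1) v ≤ ((n + 1 + k).choose k : ℝ) * G.reward v u + F n u)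
    (hl : Tendsto (fun n : ℕ => ((F n v₀ / ((n : ℝ) + 1) : ℝ) : EReal)) atTop (𝓝 l))
    (x : ℝ) (hx : x < l) :
    ∃ T₀ : ℕ, ∀ (b : G.Strategy .min) (w : G.Strategy .max), Conforms b w A → ∀ T ≥ T₀,
      x ≤ momentAverage k (expectedRewards b w v₀) T := by
  obtain ⟨N, hN⟩ := eventually_atTop.1 hF
  obtain ⟨C, hC⟩ := G.exists_moment_le_of_conforms (k := k) (A := A) (-1) (F := F) (N := N)
    fun n hn v u h => by simpa using hN n hn v u h
  obtain ⟨M, hM⟩ := eventually_atTop.1 ((tendsto_coe_add_const_div hl (-C)).eventually_const_lt hx)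
  refine ⟨N + M + 1, fun b w hA T hT => ?_⟩
  obtain ⟨n, rfl⟩ := Nat.exists_eq_add_of_le' (le_trans (Nat.le_add_left 1 _) hT)
  have h1 := hC b w hA v₀ n (by omega)
  have h2 := EReal.coe_lt_coe_iff.1 (hM n (by omega))
  rw [momentAverage_succ]
  refine h2.le.trans ?_
  gcongr
  linarith

variable {b : G.Strategy .min} {w : G.Strategy .max}

theorem Conforms.limsup_momentAverage_le (hA : Conforms b w A)
    (hF : ∀ᶠ n in atTop, ∀ v u, A v u →
      ((n + 1 + k).choose k : ℝ) * G.reward v u + F n u ≤ F (n + 1) v)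
    (hl : Tendsto (fun n : ℕ => ((F n v₀ / ((n : ℝ) + 1) : ℝ) : EReal)) atTop (𝓝 l)) :
    limsup (fun T : ℕ => (momentAverage k (expectedRewards b w v₀) T : EReal)) atTop ≤ l := by
  refine le_of_forall_gt fun y hy => ?_
  obtain ⟨x, hx, hxy⟩ := EReal.lt_iff_exists_real_btwn.1 hy
  obtain ⟨T₀, hT₀⟩ := exists_forall_momentAverage_le hF hl x hx
  refine lt_of_le_of_lt (limsup_le_of_le (by isBoundedDefault) ?_) hxy
  filter_upwards [eventually_ge_atTop T₀] with T hT using EReal.coe_le_coe_iff.2 (hT₀ b w hA T hT)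

theorem Conforms.le_payoff (hA : Conforms b w A)
    (hF : ∀ᶠ n in atTop, ∀ v u, A v u →
      F (n + 1) v ≤ ((n + 1 + k).choose k : ℝ) * G.reward v u + F n u)
    (hl : Tendsto (fun n : ℕ => ((F n v₀ / ((n : ℝ) + 1) : ℝ) : EReal)) atTop (𝓝 l)) :
    l ≤ payoff k b w v₀ := by
  refine le_of_forall_lt fun y hy => ?_
  obtain ⟨x, hyx, hx⟩ := EReal.lt_iff_exists_real_btwn.1 hy
  obtain ⟨T₀, hT₀⟩ := exists_forall_le_momentAverage hF hl x hx
  refine lt_of_lt_of_le hyx (le_liminf_of_le (by isBoundedDefault) ?_)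
  filter_upwards [eventually_ge_atTop T₀] with T hT using EReal.coe_le_coe_iff.2 (hT₀ b w hA T hT)

theorem Conforms.payoff_le (hA : Conforms b w A)
    (hF : ∀ᶠ n in atTop, ∀ v u, A v u →
      ((n + 1 + k).choose k : ℝ) * G.reward v u + F n u ≤ F (n + 1) v)
    (hl : Tendsto (fun n : ℕ => ((F n v₀ / ((n : ℝ) + 1) : ℝ) : EReal)) atTop (𝓝 l)) :
    payoff k b w v₀ ≤ l :=
  (liminf_le_limsup (by isBoundedDefault) (by isBoundedDefault)).trans (hA.limsup_momentAverage_le hF hl)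

theorem payoff_toStrategy_eq {b : G.PureStationary .min} {w : G.PureStationary .max}
    {σ : V → V} (hb : ∀ v hv, b.next v hv = σ v) (hw : ∀ v hv, w.next v hv = σ v)
    (hF : ∀ᶠ n in atTop, ∀ v,
      F (n + 1) v = ((n + 1 + k).choose k : ℝ) * G.reward v (σ v) + F n (σ v))
    (hl : Tendsto (fun n : ℕ => ((F n v₀ / ((n : ℝ) + 1) : ℝ) : EReal)) atTop (𝓝 l)) :
    payoff k b.toStrategy w.toStrategy v₀ = l := by
  have hA := conforms_toStrategy_toStrategy hb hw
  refine le_antisymm (hA.payoff_le (hF.mono fun n h v u hu => ?_) hl)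
    (hA.le_payoff (hF.mono fun n h v u hu => ?_) hl)
  · rw [hu, h]
  · rw [hu, h]

/-! ### Best responses and the saddle point -/

theorem exists_bestResponseMax (b : G.PureStationary .min) (k : ℕ) :
    ∃ w : G.PureStationary .max, ∀ v₀ : V,
      IsBestResponseMax k v₀ b.toStrategy w.toStrategy ∧
      (∀ w' : G.Strategy .max,
        limsup (fun T : ℕ =>
            (momentAverage k (expectedRewards b.toStrategy w' v₀) T : EReal)) atTop
          ≤ payoff k b.toStrategy w.toStrategy v₀) ∧
      (∀ x : ℝ, payoff k b.toStrategy w.toStrategy v₀ < (x : EReal) →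
        ∃ T₀ : ℕ, ∀ w' : G.Strategy .max, ∀ T ≥ T₀,
          momentAverage k (expectedRewards b.toStrategy w' v₀) T ≤ x) := by
  obtain ⟨σ, F, hadj, hl, hF⟩ := b.boundGame.exists_isHorizonOptimal k
  -- In the bound game `σ` can only follow `b` at positions of the minimizer.
  have hb : ∀ v hv, b.next v hv = σ v := fun v hv => ((hadj v).2 hv).symm
  let w : G.PureStationary .max := ⟨fun v _ => σ v, fun v _ => (hadj v).1⟩
  have hF' : ∀ᶠ n in atTop, ∀ v u, b.Allows v u →
      ((n + 1 + k).choose k : ℝ) * G.reward v u + F n u ≤ F (n + 1) v :=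
    hF.mono fun n h v u hvu => by
      cases hv : G.owner v with
      | min =>
        rw [hvu.2 hv, hb]
        exact (h.eq v).ge
      | max => exact h.le v u hvu hv
  refine ⟨w, fun v₀ => ?_⟩
  obtain ⟨l, hl⟩ := hl v₀
  rw [IsBestResponseMax, payoff_toStrategy_eq hb (fun _ _ => rfl) (hF.mono fun n h => h.eq) hl]
  refine ⟨fun w' => (conforms_toStrategy_min b w').payoff_le hF' hl,
    fun w' => (conforms_toStrategy_min b w').limsup_momentAverage_le hF' hl, fun x hx => ?_⟩
  obtain ⟨T₀, h⟩ := exists_forall_momentAverage_le hF' hl x hx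
  exact ⟨T₀, fun w' => h _ _ (conforms_toStrategy_min b w')⟩

theorem exists_bestResponseMin (w : G.PureStationary .max) (k : ℕ) :
    ∃ b : G.PureStationary .min, ∀ v₀ : V,
      IsBestResponseMin k v₀ b.toStrategy w.toStrategy ∧
      (∀ b' : G.Strategy .min,
        payoff k b.toStrategy w.toStrategy v₀ ≤
          liminf (fun T : ℕ =>
            (momentAverage k (expectedRewards b' w.toStrategy v₀) T : EReal)) atTop) ∧
      (∀ x : ℝ, (x : EReal) < payoff k b.toStrategy w.toStrategy v₀ →
        ∃ T₀ : ℕ, ∀ b' : G.Strategy .min, ∀ T ≥ T₀,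
          x ≤ momentAverage k (expectedRewards b' w.toStrategy v₀) T) := by
  obtain ⟨σ, F, hadj, hl, hF⟩ := w.boundGame.exists_isHorizonOptimal k
  have hw : ∀ v hv, w.next v hv = σ v := fun v hv => ((hadj v).2 hv).symm
  let b : G.PureStationary .min := ⟨fun v _ => σ v, fun v _ => (hadj v).1⟩
  have hF' : ∀ᶠ n in atTop, ∀ v u, w.Allows v u →
      F (n + 1) v ≤ ((n + 1 + k).choose k : ℝ) * G.reward v u + F n u :=
    hF.mono fun n h v u hvu => by
      cases hv : G.owner v with
      | max =>
        rw [hvu.2 hv, hw]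
        exact (h.eq v).le
      | min => exact h.ge v u hvu hv
  refine ⟨b, fun v₀ => ?_⟩
  obtain ⟨l, hl⟩ := hl v₀
  rw [IsBestResponseMin, payoff_toStrategy_eq (fun _ _ => rfl) hw (hF.mono fun n h => h.eq) hl]
  have h1 := fun b' => (conforms_toStrategy_max b' w).le_payoff hF' hl
  refine ⟨h1, h1, fun x hx => ?_⟩
  obtain ⟨T₀, h⟩ := exists_forall_le_momentAverage hF' hl x hx
  exact ⟨T₀, fun b' => h _ _ (conforms_toStrategy_max b' w)⟩

theorem exists_isSaddlePoint (G : BWGame V) (k : ℕ) :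
    ∃ (b : G.PureStationary .min) (w : G.PureStationary .max),
      ∀ v₀ : V, IsSaddlePoint k v₀ b.toStrategy w.toStrategy := by
  obtain ⟨σ, F, hadj, hl, hF⟩ := G.exists_isHorizonOptimal k
  refine ⟨⟨fun v _ => σ v, fun v _ => hadj v⟩, ⟨fun v _ => σ v, fun v _ => hadj v⟩, fun v₀ => ?_⟩
  obtain ⟨l, hl⟩ := hl v₀
  rw [IsSaddlePoint, IsBestResponseMax, IsBestResponseMin,
    payoff_toStrategy_eq (σ := σ) (fun _ _ => rfl) (fun _ _ => rfl) (hF.mono fun n h => h.eq) hl]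
  exact ⟨fun w' => (conforms_toStrategy_min _ w').payoff_le
      (hF.mono fun n h => h.le_of_allows fun _ _ => rfl) hl,
    fun b' => (conforms_toStrategy_max b' _).le_payoff
      (hF.mono fun n h => h.ge_of_allows fun _ _ => rfl) hl⟩

end BWGame

theorem theorem2 {V : Type*} [Fintype V] (G : BWGame V) (k : ℕ) :
    -- the maximizer responds to a pure stationary strategy of the minimizer
    (∀ b : G.PureStationary .min, ∃ w : G.PureStationary .max, ∀ v₀ : V,
      BWGame.IsBestResponseMax k v₀ b.toStrategy w.toStrategy ∧
      (∀ w' : G.Strategy .max,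
        limsup (fun T : ℕ =>
            (momentAverage k (BWGame.expectedRewards b.toStrategy w' v₀) T : EReal)) atTop
          ≤ BWGame.payoff k b.toStrategy w.toStrategy v₀) ∧
      (∀ x : ℝ, BWGame.payoff k b.toStrategy w.toStrategy v₀ < (x : EReal) →
        ∃ T₀ : ℕ, ∀ w' : G.Strategy .max, ∀ T ≥ T₀,
          momentAverage k (BWGame.expectedRewards b.toStrategy w' v₀) T ≤ x)) ∧
    -- the minimizer responds to a pure stationary strategy of the maximizer
    (∀ w : G.PureStationary .max, ∃ b : G.PureStationary .min, ∀ v₀ : V,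
      BWGame.IsBestResponseMin k v₀ b.toStrategy w.toStrategy ∧
      (∀ b' : G.Strategy .min,
        BWGame.payoff k b.toStrategy w.toStrategy v₀ ≤
          liminf (fun T : ℕ =>
            (momentAverage k (BWGame.expectedRewards b' w.toStrategy v₀) T : EReal)) atTop) ∧
      (∀ x : ℝ, (x : EReal) < BWGame.payoff k b.toStrategy w.toStrategy v₀ →
        ∃ T₀ : ℕ, ∀ b' : G.Strategy .min, ∀ T ≥ T₀,
          x ≤ momentAverage k (BWGame.expectedRewards b' w.toStrategy v₀) T)) ∧
    -- a saddle point in pure stationary strategies, the same for all initial positions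
    (∃ (b : G.PureStationary .min) (w : G.PureStationary .max),
      ∀ v₀ : V, BWGame.IsSaddlePoint k v₀ b.toStrategy w.toStrategy) := by
  exact ⟨fun b => BWGame.exists_bestResponseMax b k, fun w => BWGame.exists_bestResponseMin w k,
    G.exists_isSaddlePoint k⟩
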